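/- Let $K$ be a non-archimedean local field with ring of integers $\mathcal{O}_K$ and uniformizer $\pi_K$. An order in $\mathbb{M}_2(K)$ is a unital $\mathcal{O}_K$-subalgebra that is finitely generated as an $\mathcal{O}_K$-module. Let $\mathfrak{t}(K)$ be the Bruhat–Tits tree, whose vertices are the maximal $\mathcal{O}_K$-orders in $\mathbb{M}_2(K)$, two of them being neighbors if in some basis they have the form $\begin{pmatrix}\mathcal{O}_K&\mathcal{O}_K\\ \mathcal{O}_K&\mathcal{O}_K\end{pmatrix}$ and $\begin{pmatrix}\mathcal{O}_K&\pi_K^{-1}\mathcal{O}_K\\ \pi_K\mathcal{O}_K&\mathcal{O}_K\end{pmatrix}$. A ghost intersection of maximal orders is an order in $\mathbb{M}_2(K)$ of the form $\mathbb{M}_2(K)\cap\mathfrak{D}_1\cap\dots\cap\mathfrak{D}_n$, where $L/K$ is some finite field extension, $\mathcal{O}_L$ is the integral closure of $\mathcal{O}_K$ in $L$, and $\mathfrak{D}_1,\dots,\mathfrak{D}_n$ are maximal $\mathcal{O}_L$-orders in $\mathbb{M}_2(L)$. Let $R$ be a ghost intersection of maximal orders, let $r\ge 0$ be an integer, and assume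 that the branch of $R$, i.e. the set of maximal $\mathcal{O}_K$-orders in $\mathbb{M}_2(K)$ containing $R$, contains a ball of radius $r$ in $\mathfrak{t}(K)$, i.e. all vertices at distance at most $r$ from some vertex. Then there is an order $\tilde R$ that is itself a ghost intersection of maximal orders and satisfies $$R=\mathcal{O}_K\mathbf{1}+\pi_K^{r}\tilde R .$$ -/

import Mathlib

open scoped ValuativeRel

universe u

section QuaternionOrders

variable {O : Type*} {F : Type*} [CommRing O] [Field F] [Algebra O F]

/-- An `O`-order in `M₂(F)`, not necessarily of maximal rank: a unital `O`-subalgebra that is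
finitely generated as an `O`-module. -/
def IsOrder (H : Subalgebra O (Matrix (Fin 2) (Fin 2) F)) : Prop :=
  Module.Finite O H

/-- A full order: an order that spans `M₂(F)` over `F`. -/
def IsFullOrder (H : Subalgebra O (Matrix (Fin 2) (Fin 2) F)) : Prop :=
  IsOrder H ∧ Submodule.span F (H : Set (Matrix (Fin 2) (Fin 2) F)) = ⊤

/-- A maximal order: a full order that is maximal under inclusion among the full orders. -/
def IsMaximalOrder (D : Subalgebra O (Matrix (Fin 2) (Fin 2) F)) : Prop :=
  Maximal IsFullOrder D

variable (O F) in
/-- The maximal `O`-orders in `M₂(F)`, i.e. the vertices of the Bruhat-Tits tree. -/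
abbrev MaximalOrder : Type _ :=
  {D : Subalgebra O (Matrix (Fin 2) (Fin 2) F) // IsMaximalOrder D}

/-- `D` and `D'` are neighbors: in some basis (given by `g`) they are
`(O, O; O, O)` and `(O, π⁻¹O; πO, O)`, where `π` is a uniformizer of `O`. -/
def AreNeighbors (D D' : MaximalOrder O F) : Prop :=
  ∃ (g : GL (Fin 2) F) (π : O), Irreducible π ∧
    (∀ y : Matrix (Fin 2) (Fin 2) F,
      g.1 * y * (g⁻¹).1 ∈ D.1 ↔ ∃ a b c d : O,
        y = !![algebraMap O F a, algebraMap O F b; algebraMap O F c, algebraMap O F d]) ∧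
    (∀ y : Matrix (Fin 2) (Fin 2) F,
      g.1 * y * (g⁻¹).1 ∈ D'.1 ↔ ∃ a b c d : O,
        y = !![algebraMap O F a, (algebraMap O F π)⁻¹ * algebraMap O F b;
               algebraMap O F π * algebraMap O F c, algebraMap O F d])

variable (O F) in
/-- The Bruhat-Tits tree of `PGL₂(F)`, with the maximal orders of `M₂(F)` as vertices.
(Over a discrete valuation ring the neighbor relation is already symmetric and irreflexive.) -/
def bruhatTitsTree : SimpleGraph (MaximalOrder O F) :=
  SimpleGraph.fromRel AreNeighbors

/-- The ball of radius `r` in the Bruhat-Tits tree around the vertex `D`: the set of vertices at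
graph distance at most `r` from `D`. -/
def treeBall (D : MaximalOrder O F) (r : ℕ) : Set (MaximalOrder O F) :=
  {D' | (bruhatTitsTree O F).edist D D' ≤ r}

/-- (The vertex set of) the branch of an order `H`: the maximal orders that contain `H`. -/
def branch (H : Subalgebra O (Matrix (Fin 2) (Fin 2) F)) : Set (MaximalOrder O F) :=
  {D | H ≤ D.1}

/-- The order `O·1 + a·H`, for `a ∈ O`. -/
def scalarsAdd (a : O) (H : Subalgebra O (Matrix (Fin 2) (Fin 2) F)) :
    Subalgebra O (Matrix (Fin 2) (Fin 2) F) where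
  carrier := {x | ∃ z : O, ∃ h ∈ H, x = algebraMap O (Matrix (Fin 2) (Fin 2) F) z + a • h}
  mul_mem' := by
    rintro _ _ ⟨z, h, hh, rfl⟩ ⟨w, k, hk, rfl⟩
    refine ⟨z * w, z • k + w • h + a • (h * k),
      add_mem (add_mem (H.smul_mem hk z) (H.smul_mem hh w)) (H.smul_mem (mul_mem hh hk) a), ?_⟩
    simp only [Algebra.algebraMap_eq_smul_one, add_mul, mul_add, smul_mul_assoc, mul_smul_comm,
      one_mul, mul_one, smul_add, smul_smul]
    rw [mul_comm a z, mul_comm a w, mul_comm w z]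
    abel
  add_mem' := by
    rintro _ _ ⟨z, h, hh, rfl⟩ ⟨w, k, hk, rfl⟩
    exact ⟨z + w, h + k, add_mem hh hk, by rw [map_add, smul_add]; abel⟩
  algebraMap_mem' z := ⟨z, 0, zero_mem H, by simp⟩

end QuaternionOrders

/-- `R` is a ghost intersection of maximal orders: an order of the form
`M₂(K) ∩ D₁ ∩ ⋯ ∩ Dₙ`, where `L/K` is a finite extension of fields and the `Dᵢ` are maximal
`𝒪_L`-orders in `M₂(L)`. Here `𝒪_L` is the integral closure of `𝒪_K` in `L`. (The empty
intersection `M₂(K)` is not an order. Restricting `L` to the universe of `K` loses nothing, as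
every finite extension of `K` has an isomorphic copy there.) -/
def IsGhostIntersection {K : Type u} [Field K] [ValuativeRel K]
    (R : Subalgebra 𝒪[K] (Matrix (Fin 2) (Fin 2) K)) : Prop :=
  IsOrder R ∧
    ∃ (L : Type u) (_ : Field L) (_ : Algebra K L) (_ : FiniteDimensional K L)
      (n : ℕ) (D : Fin n → MaximalOrder (integralClosure 𝒪[K] L) L),
      ∀ x : Matrix (Fin 2) (Fin 2) K, x ∈ R ↔ ∀ i, x.map (algebraMap K L) ∈ (D i).1

/-! Let `D` be the center of the ball. Conjugates of elements of `R` by all of GL₂(𝒪_K) are seen at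
the boundary of the ball, which forces `R` ≤ 𝒪_K + πʳ`D`. Hence `R` = 𝒪_K + πʳ`R'` with `R'` = {h ∈
`D` : πʳh ∈ `R`}, and only the ghost form of `R'` is at issue. Over `L`, take one maximal order E
from the ghost form of `R`. The Cartan decomposition places the base change of `D` at M₂(𝒪_L) and E
at its conjugate by diag(1, c). For integral h, the condition πʳh ∈ E concerns a single entry. It
says that h lies in the order of diag(1, c/πʳ), i.e. E moved towards `D`, or says nothing if c
divides πʳ (`exists_conjOrder_smul_mem_iff`). So `R'` is cut out by the moved orders together with
the base change of `D`. All this needs only that 𝒪_L is a valuation ring. -/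

open ValuativeRel in
/-- The integral closure of the ring of integers of a local field in a finite extension is a
valuation ring. -/
theorem valuationRing_integralClosure {K : Type*} [Field K] [ValuativeRel K] [TopologicalSpace K]
    [IsNonarchimedeanLocalField K] (L : Type*) [Field L] [Algebra K L] [FiniteDimensional K L] :
    ValuationRing (integralClosure 𝒪[K] L) := by
  have : IsFractionRing (integralClosure 𝒪[K] L) L :=
    integralClosure.isFractionRing_of_finite_extension K L
  rw [ValuationRing.iff_isInteger_or_isInteger _ L]
  let := IsTopologicalAddGroup.rightUniformSpace K
  have := isUniformAddGroup_of_addCommGroup (G := K)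
  -- The spectral norm needs a real-valued absolute value on `K`, so the value group is embedded in
  -- the reals.
  let : (Valued.v (R := K)).RankOne :=
  { hom' := IsRankLeOne.nonempty.some.emb (R := K).comp MonoidWithZeroHom.ValueGroup₀.embedding
    strictMono' := IsRankLeOne.nonempty.some.strictMono.comp
        MonoidWithZeroHom.ValueGroup₀.embedding_strictMono }
  let : NontriviallyNormedField K :=
    Valued.toNontriviallyNormedField K (ValueGroupWithZero K)
  have : IsUltrametricDist K := inferInstance
  have hn (x : K) (h : ‖x‖ ≤ 1) : x ∈ 𝒪[K] := Valued.toNormedField.norm_le_one_iff.1 h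
  -- The spectral norm is at most 1 exactly when all coefficients of the minimal polynomial are
  -- integral.
  have key (x : L) (hx : spectralNorm K L x ≤ 1) :
      IsLocalization.IsInteger (integralClosure 𝒪[K] L) x := by
    have hm := minpoly.monic (Algebra.IsIntegral.isIntegral (R := K) x)
    have h := (spectralValue_le_one_iff hm).1 hx
    have hl : minpoly K x ∈ Polynomial.lifts (algebraMap 𝒪[K] K) := by
      rw [Polynomial.lifts_iff_coeff_lifts]
      exact fun n => ⟨⟨_, hn _ (h n)⟩, rfl⟩
    obtain ⟨q, hq, -, hqm⟩ := Polynomial.lifts_and_natDegree_eq_and_monic hl hm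
    refine ⟨⟨x, q, hqm, ?_⟩, rfl⟩
    rw [IsScalarTower.algebraMap_eq 𝒪[K] K L, ← Polynomial.eval₂_map, hq]
    exact minpoly.aeval K x
  intro x
  rcases eq_or_ne x 0 with rfl | hx
  · exact Or.inl ⟨0, by simp⟩
  rcases le_total (spectralNorm K L x) 1 with h | h
  · exact Or.inl (key x h)
  · refine Or.inr (key _ ?_)
    have h1 := spectralAlgNorm_mul (K := K) x x⁻¹
    rw [mul_inv_cancel₀ hx, spectralAlgNorm_one] at h1
    simp only [spectralAlgNorm_def] at h1
    have h0 := spectralNorm_nonneg (K := K) x⁻¹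
    nlinarith

/-! ### Maximal orders as conjugates of M₂(O) -/

section ConjugateOrders

variable {O : Type*} {F : Type*} [CommRing O] [Field F] [Algebra O F]

variable (O) in
/-- The embedding `M ↦ g M g⁻¹` of `M₂(O)` in `M₂(F)`. -/
def conjEmbedding (g : GL (Fin 2) F) :
    Matrix (Fin 2) (Fin 2) O →ₐ[O] Matrix (Fin 2) (Fin 2) F where
  toFun M := g.1 * M.map (algebraMap O F) * (g⁻¹).1
  map_one' := by simp [Matrix.map_one]
  map_mul' M N := by
    rw [Matrix.map_mul]
    simp only [mul_assoc, Units.inv_mul_cancel_left]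
  map_zero' := by simp
  map_add' M N := by rw [Matrix.map_add _ (map_add _), mul_add, add_mul]
  commutes' a := by
    have : (algebraMap O (Matrix (Fin 2) (Fin 2) O) a).map (algebraMap O F) =
        algebraMap O (Matrix (Fin 2) (Fin 2) F) a := by
      ext i j
      simp only [Matrix.map_apply, Matrix.algebraMap_matrix_apply, apply_ite (algebraMap O F),
        map_zero, Algebra.algebraMap_self, RingHom.id_apply]
    rw [this, ← Algebra.commutes, mul_assoc, Units.mul_inv, mul_one]

theorem conjEmbedding_apply (g : GL (Fin 2) F) (M : Matrix (Fin 2) (Fin 2) O) :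
    conjEmbedding O g M = g.1 * M.map (algebraMap O F) * (g⁻¹).1 := rfl

variable (O) in
/-- The order `g M₂(O) g⁻¹`. -/
def conjOrder (g : GL (Fin 2) F) : Subalgebra O (Matrix (Fin 2) (Fin 2) F) :=
  (conjEmbedding O g).range

theorem conjEmbedding_mem (g : GL (Fin 2) F) (M : Matrix (Fin 2) (Fin 2) O) :
    conjEmbedding O g M ∈ conjOrder O g := ⟨M, rfl⟩

theorem conjEmbedding_single (g : GL (Fin 2) F) (i j : Fin 2) :
    conjEmbedding O g (Matrix.single i j 1) = g.1 * Matrix.single i j 1 * (g⁻¹).1 := by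
  rw [conjEmbedding_apply, Matrix.map_single, map_one]

theorem mem_conjOrder_iff {g : GL (Fin 2) F} {x : Matrix (Fin 2) (Fin 2) F} :
    x ∈ conjOrder O g ↔ ∀ i j, ∃ a : O, algebraMap O F a = ((g⁻¹).1 * x * g.1) i j := by
  rw [conjOrder, AlgHom.mem_range]
  constructor
  · rintro ⟨M, rfl⟩ i j
    refine ⟨M i j, ?_⟩
    simp only [conjEmbedding_apply, mul_assoc, Units.inv_mul_cancel_left, Units.inv_mul,
      mul_one, Matrix.map_apply]
  · intro h
    choose M hM using h
    refine ⟨Matrix.of M, ?_⟩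
    have : (Matrix.of M).map (algebraMap O F) = (g⁻¹).1 * x * g.1 := by
      ext i j
      exact hM i j
    simp only [conjEmbedding_apply, this, mul_assoc, Units.mul_inv_cancel_left, Units.mul_inv,
      mul_one]

theorem conj_mem_conjOrder_mul_iff {g h : GL (Fin 2) F} {y : Matrix (Fin 2) (Fin 2) F} :
    g.1 * y * (g⁻¹).1 ∈ conjOrder O (g * h) ↔ y ∈ conjOrder O h := by
  simp only [mem_conjOrder_iff, mul_inv_rev, Units.val_mul, mul_assoc, Units.inv_mul_cancel_left]

theorem mem_conjOrder_mul_iff {g h : GL (Fin 2) F} {x : Matrix (Fin 2) (Fin 2) F} :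
    x ∈ conjOrder O (g * h) ↔ (g⁻¹).1 * x * g.1 ∈ conjOrder O h := by
  simp only [mem_conjOrder_iff, mul_inv_rev, Units.val_mul, mul_assoc]

theorem map_mem_conjOrder_one (M : Matrix (Fin 2) (Fin 2) O) :
    M.map (algebraMap O F) ∈ conjOrder O (1 : GL (Fin 2) F) :=
  mem_conjOrder_iff.2 fun i j => ⟨M i j, by simp⟩

theorem conjOrder_map_le (k : GL (Fin 2) O) :
    conjOrder O (Matrix.GeneralLinearGroup.map (algebraMap O F) k) ≤
      conjOrder O (1 : GL (Fin 2) F) := by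
  rintro _ ⟨M, rfl⟩
  change conjEmbedding O _ M ∈ _
  rw [conjEmbedding_apply, ← map_inv]
  exact mul_mem (mul_mem (map_mem_conjOrder_one k.1) (map_mem_conjOrder_one M))
    (map_mem_conjOrder_one (k⁻¹).1)

theorem conjOrder_mul_map (g : GL (Fin 2) F) (k : GL (Fin 2) O) :
    conjOrder O (g * Matrix.GeneralLinearGroup.map (algebraMap O F) k) = conjOrder O g := by
  have key (g : GL (Fin 2) F) (k : GL (Fin 2) O) :
      conjOrder O (g * Matrix.GeneralLinearGroup.map (algebraMap O F) k) ≤ conjOrder O g := by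
    intro x hx
    rw [mem_conjOrder_mul_iff] at hx
    rw [← mul_one g, mem_conjOrder_mul_iff]
    exact conjOrder_map_le k hx
  refine le_antisymm (key g k) ?_
  have := key (g * Matrix.GeneralLinearGroup.map (algebraMap O F) k) k⁻¹
  rwa [map_inv, mul_inv_cancel_right] at this

theorem isOrder_conjOrder (g : GL (Fin 2) F) : IsOrder (conjOrder O g) :=
  Module.Finite.of_surjective (conjEmbedding O g).rangeRestrict.toLinearMap
    (conjEmbedding O g).rangeRestrict_surjective

theorem isFullOrder_conjOrder (g : GL (Fin 2) F) : IsFullOrder (conjOrder O g) := by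
  refine ⟨isOrder_conjOrder g, eq_top_iff.2 fun x _ => ?_⟩
  have hx : x = ∑ i, ∑ j, ((g⁻¹).1 * x * g.1) i j • conjEmbedding O g (Matrix.single i j 1) := by
    have h1 (i j : Fin 2) (c : F) : c • conjEmbedding O g (Matrix.single i j 1) =
        g.1 * Matrix.single i j c * (g⁻¹).1 := by
      rw [conjEmbedding_single, ← smul_mul_assoc, ← mul_smul_comm, Matrix.smul_single,
        smul_eq_mul, mul_one]
    simp only [h1, ← Finset.sum_mul, ← Finset.mul_sum, ← Matrix.matrix_eq_sum_single]
    simp only [mul_assoc, Units.mul_inv_cancel_left, Units.mul_inv, mul_one]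
  rw [hx]
  exact sum_mem fun i _ => sum_mem fun j _ => Submodule.smul_mem _ _
    (Submodule.subset_span (conjEmbedding_mem g _))

/-- Matrix units isolate each entry of g⁻¹xg as a scalar matrix inside the larger order `H`. As `H`
is finite over `O`, that scalar is integral, hence in `O`. -/
theorem isMaximalOrder_conjOrder [IsDomain O] [IsIntegrallyClosed O] [IsFractionRing O F]
    (g : GL (Fin 2) F) : IsMaximalOrder (conjOrder O g) := by
  refine ⟨isFullOrder_conjOrder g, fun H hH hle x hx => mem_conjOrder_iff.2 fun j k => ?_⟩
  rw [← IsIntegrallyClosed.isIntegral_iff]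
  have hs : algebraMap F (Matrix (Fin 2) (Fin 2) F) (((g⁻¹).1 * x * g.1) j k) =
      ∑ i, conjEmbedding O g (Matrix.single i j 1) * x *
        conjEmbedding O g (Matrix.single k i 1) := by
    have h1 (i : Fin 2) : conjEmbedding O g (Matrix.single i j 1) * x *
        conjEmbedding O g (Matrix.single k i 1) =
        g.1 * Matrix.single i i (((g⁻¹).1 * x * g.1) j k) * (g⁻¹).1 := by
      have : Matrix.single i i (((g⁻¹).1 * x * g.1) j k) =
          Matrix.single i j 1 * ((g⁻¹).1 * x * g.1) * Matrix.single k i 1 := by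
        rw [Matrix.single_mul_mul_single, one_mul, mul_one]
      rw [this]
      simp only [conjEmbedding_single, mul_assoc]
    have h2 (c : F) : ∑ i : Fin 2, Matrix.single i i c =
        algebraMap F (Matrix (Fin 2) (Fin 2) F) c := by
      ext i j
      fin_cases i <;> fin_cases j <;> simp [Matrix.algebraMap_matrix_apply]
    simp only [h1, ← Finset.sum_mul, ← Finset.mul_sum, h2]
    rw [← Algebra.commutes (_ : F) g.1, mul_assoc _ g.1, Units.mul_inv, mul_one]
  have hmem : algebraMap F (Matrix (Fin 2) (Fin 2) F) (((g⁻¹).1 * x * g.1) j k) ∈ H := by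
    rw [hs]
    exact sum_mem fun i _ => mul_mem (mul_mem (hle (conjEmbedding_mem g _)) hx)
      (hle (conjEmbedding_mem g _))
  have : Module.Finite O H := hH.1
  have hint := (IsIntegral.of_finite O (⟨_, hmem⟩ : H)).map H.val
  refine (isIntegral_algHom_iff (IsScalarTower.toAlgHom O F (Matrix (Fin 2) (Fin 2) F))
    (algebraMap F (Matrix (Fin 2) (Fin 2) F)).injective).1 hint

variable (O) in
/-- The vertex `g M₂(O) g⁻¹` of the Bruhat-Tits tree. -/
def conjVertex [IsDomain O] [IsIntegrallyClosed O] [IsFractionRing O F] (g : GL (Fin 2) F) :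
    MaximalOrder O F :=
  ⟨conjOrder O g, isMaximalOrder_conjOrder g⟩

/-- Over a valuation ring, every maximal order of `M₂(F)` is conjugate to `M₂(O)`. -/
theorem IsMaximalOrder.exists_eq_conjOrder [IsDomain O] [ValuationRing O] [IsFractionRing O F]
    {D : Subalgebra O (Matrix (Fin 2) (Fin 2) F)} (hD : IsMaximalOrder D) :
    ∃ g : GL (Fin 2) F, D = conjOrder O g := by
  have : Module.IsTorsionFree O F :=
    Module.isTorsionFree_iff_algebraMap_injective.2 (IsFractionRing.injective O F)
  let c : Matrix (Fin 2) (Fin 2) F →ₗ[F] (Fin 2 → F) :=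
    (Matrix.mulVecBilin F F).flip (Pi.single 0 1)
  have hc (x) : c x = x.mulVec (Pi.single 0 1) := rfl
  -- The lattice `D`e₀ is stable under `D`; a basis of it will be the columns of `g`.
  let Λ : Submodule O (Fin 2 → F) := (Subalgebra.toSubmodule D).map (c.restrictScalars O)
  have hfin : Module.Finite O D := hD.1.1
  have : Module.Finite O Λ := by
    have : Module.Finite O (Subalgebra.toSubmodule D) := hfin
    exact Module.Finite.map _ _
  -- Over a valuation ring torsion-free implies flat, and a finite flat module over a local ring is
  -- free.
  have : Module.Flat O Λ :=
    Module.Flat.flat_iff_torsion_eq_bot_of_isBezout.2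
      (Submodule.isTorsionFree_iff_torsion_eq_bot.1 inferInstance)
  have : Module.Free O Λ := Module.free_of_flat_of_isLocalRing
  let b := Module.Free.chooseBasis O Λ
  let v : Module.Free.ChooseBasisIndex O Λ → (Fin 2 → F) := fun i => (b i : Fin 2 → F)
  have hli : LinearIndependent F v :=
    (LinearIndependent.iff_fractionRing O F).1
      (b.linearIndependent.map' Λ.subtype (Submodule.ker_subtype _))
  have hΛ : Submodule.span O (Set.range v) = Λ := by
    have := congrArg (Submodule.map Λ.subtype) b.span_eq
    rwa [Submodule.map_span, ← Set.range_comp, Submodule.map_subtype_top] at this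
  have hsp : Submodule.span F (Set.range v) = ⊤ := by
    rw [← Submodule.span_span_of_tower O, hΛ]
    have : (Λ : Set (Fin 2 → F)) = c '' D := rfl
    rw [this, ← Submodule.map_span, hD.1.2, Submodule.map_top, LinearMap.range_eq_top]
    intro w
    refine ⟨Matrix.of fun i j => w i, ?_⟩
    rw [hc]
    ext i
    simp
  let B := Module.Basis.mk hli hsp.ge
  have hcard : Fintype.card (Module.Free.ChooseBasisIndex O Λ) = Fintype.card (Fin 2) := by
    rw [← Module.finrank_eq_card_basis B]; simp
  let e := Fintype.equivOfCardEq hcard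
  let b' := b.reindex e
  let B' := B.reindex e
  have hB (j : Fin 2) : B' j = (b' j : Fin 2 → F) := by simp [B', b', B, v]
  let P : Matrix (Fin 2) (Fin 2) F := Matrix.of fun i j => B' j i
  have hP : IsUnit P := by
    rw [← Matrix.linearIndependent_cols_iff_isUnit]
    exact B'.linearIndependent
  obtain ⟨g, hg⟩ := hP
  -- Stability of the lattice gives one inclusion; maximality of `D` gives equality.
  refine ⟨g, hD.eq_of_le (isFullOrder_conjOrder g) fun x hx => ?_⟩
  have hst (j : Fin 2) : x.mulVec (B' j) ∈ Λ := by
    rw [hB]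
    obtain ⟨y, hy, hyj⟩ := (b' j).2
    refine ⟨x * y, D.mul_mem hx hy, ?_⟩
    rw [← hyj]
    exact (Matrix.mulVec_mulVec (Pi.single 0 1) x y).symm
  choose m hm using fun j => (⟨b'.repr ⟨_, hst j⟩, b'.sum_repr ⟨_, hst j⟩⟩ :
    ∃ m : Fin 2 → O, ∑ i, m i • b' i = ⟨x.mulVec (B' j), hst j⟩)
  have hxP : x * g.1 = g.1 * (Matrix.of fun i j => m j i).map (algebraMap O F) := by
    ext i j
    have h1 := congrFun (congrArg Subtype.val (hm j)) i
    simp only [Submodule.coe_sum, Submodule.coe_smul, ← hB] at h1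
    rw [hg]
    simp only [Matrix.mul_apply, P, Matrix.of_apply, Matrix.map_apply]
    simp only [Matrix.mulVec, dotProduct, Finset.sum_apply, Algebra.smul_def] at h1
    rw [← h1]
    exact Finset.sum_congr rfl fun _ _ => mul_comm _ _
  refine ⟨Matrix.of fun i j => m j i, ?_⟩
  change conjEmbedding O g _ = x
  rw [conjEmbedding_apply, ← hxP, mul_assoc, Units.mul_inv, mul_one]

end ConjugateOrders

/-! ### Cartan decomposition and pairs of maximal orders -/

section RelativePosition

variable {O : Type*} {F : Type*} [CommRing O] [Field F] [Algebra O F]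

/-- The diagonal matrix `diag(a, b)` as an element of `GL₂(F)`. -/
def diagGL {a b : F} (ha : a ≠ 0) (hb : b ≠ 0) : GL (Fin 2) F :=
  Matrix.GeneralLinearGroup.mkOfDetNeZero !![a, 0; 0, b]
    (by rw [Matrix.det_fin_two_of]; simp [ha, hb])

theorem diagGL_conj {a b : F} (ha : a ≠ 0) (hb : b ≠ 0) (y : Matrix (Fin 2) (Fin 2) F) :
    ((diagGL ha hb)⁻¹).1 * y * (diagGL ha hb).1 =
      !![y 0 0, a⁻¹ * y 0 1 * b; b⁻¹ * y 1 0 * a, y 1 1] := by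
  have h1 : (diagGL ha hb).1 = !![a, 0; 0, b] := rfl
  have h2 : ((diagGL ha hb)⁻¹).1 = !![a⁻¹, 0; 0, b⁻¹] := by
    rw [← mul_one ((diagGL ha hb)⁻¹).1, Units.inv_mul_eq_iff_eq_mul, h1]
    ext i j
    fin_cases i <;> fin_cases j <;> simp [Matrix.mul_apply, ha, hb]
  rw [h1, h2, Matrix.eta_fin_two y, Matrix.mul_fin_two, Matrix.mul_fin_two]
  simp [ha, hb, mul_right_comm]

theorem mem_conjOrder_diagGL_iff {a b : F} (ha : a ≠ 0) (hb : b ≠ 0)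
    {y : Matrix (Fin 2) (Fin 2) F} :
    y ∈ conjOrder O (diagGL ha hb) ↔
      (∃ s : O, algebraMap O F s = y 0 0) ∧ (∃ s : O, algebraMap O F s = a⁻¹ * y 0 1 * b) ∧
      (∃ s : O, algebraMap O F s = b⁻¹ * y 1 0 * a) ∧ (∃ s : O, algebraMap O F s = y 1 1) := by
  rw [mem_conjOrder_iff, diagGL_conj]
  simp [Fin.forall_fin_two, and_assoc]

theorem mem_conjOrder_one_iff {y : Matrix (Fin 2) (Fin 2) F} :
    y ∈ conjOrder O (1 : GL (Fin 2) F) ↔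
      (∃ s : O, algebraMap O F s = y 0 0) ∧ (∃ s : O, algebraMap O F s = y 0 1) ∧
      (∃ s : O, algebraMap O F s = y 1 0) ∧ (∃ s : O, algebraMap O F s = y 1 1) := by
  rw [mem_conjOrder_iff]
  simp [Fin.forall_fin_two, and_assoc]

variable (O) in
/-- The permutation matrix that exchanges the two basis vectors. -/
def swapGL : GL (Fin 2) O where
  val := !![0, 1; 1, 0]
  inv := !![0, 1; 1, 0]
  val_inv := by ext i j; fin_cases i <;> fin_cases j <;> simp [Matrix.mul_apply]
  inv_val := by ext i j; fin_cases i <;> fin_cases j <;> simp [Matrix.mul_apply]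

/-- The lower unitriangular matrix with entry `t`. -/
def lowerGL (t : O) : GL (Fin 2) O where
  val := !![1, 0; t, 1]
  inv := !![1, 0; -t, 1]
  val_inv := by ext i j; fin_cases i <;> fin_cases j <;> simp [Matrix.mul_apply]
  inv_val := by ext i j; fin_cases i <;> fin_cases j <;> simp [Matrix.mul_apply]

/-- The upper unitriangular matrix with entry `t`. -/
def upperGL (t : O) : GL (Fin 2) O where
  val := !![1, t; 0, 1]
  inv := !![1, -t; 0, 1]
  val_inv := by ext i j; fin_cases i <;> fin_cases j <;> simp [Matrix.mul_apply]
  inv_val := by ext i j; fin_cases i <;> fin_cases j <;> simp [Matrix.mul_apply]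

/-- The top left entry divides all others, so it serves as pivot to clear its row and column over
`O`. -/
theorem exists_cartan_of_dvd [IsFractionRing O F] (h : GL (Fin 2) F)
    (hdvd : ∀ i j, ∃ t : O, h.1 i j = h.1 0 0 * algebraMap O F t) :
    ∃ (k₁ k₂ : GL (Fin 2) O) (a b : F) (ha : a ≠ 0) (hb : b ≠ 0) (c : O),
      b = a * algebraMap O F c ∧
      h = Matrix.GeneralLinearGroup.map (algebraMap O F) k₁ * diagGL ha hb *
        Matrix.GeneralLinearGroup.map (algebraMap O F) k₂ := by
  obtain ⟨s, hs⟩ := hdvd 0 1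
  obtain ⟨t, ht⟩ := hdvd 1 0
  obtain ⟨d, hd⟩ := hdvd 1 1
  have hdet : h.1.det ≠ 0 := ((Matrix.isUnit_iff_isUnit_det _).1 h.isUnit).ne_zero
  rw [Matrix.det_fin_two, hs, ht, hd] at hdet
  have ha : h.1 0 0 ≠ 0 := fun h0 => hdet (by simp [h0])
  have hb : h.1 0 0 * algebraMap O F (d - s * t) ≠ 0 := by
    refine fun h0 => hdet ?_
    rw [map_sub, map_mul] at h0
    linear_combination h.1 0 0 * h0
  refine ⟨lowerGL t, upperGL s, _, _, ha, hb, _, rfl, Units.ext ?_⟩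
  change h.1 = (!![1, 0; t, 1] : Matrix (Fin 2) (Fin 2) O).map (algebraMap O F) *
    !![h.1 0 0, 0; 0, h.1 0 0 * algebraMap O F (d - s * t)] *
    (!![1, s; 0, 1] : Matrix (Fin 2) (Fin 2) O).map (algebraMap O F)
  ext i j
  fin_cases i <;> fin_cases j <;> simp [Matrix.mul_apply, hs, ht, hd] <;> ring

/-- The Cartan decomposition in `GL₂` over the fraction field of a valuation ring. -/
theorem exists_cartan [IsDomain O] [ValuationRing O] [IsFractionRing O F] (h : GL (Fin 2) F) :
    ∃ (k₁ k₂ : GL (Fin 2) O) (a b : F) (ha : a ≠ 0) (hb : b ≠ 0) (c : O),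
      b = a * algebraMap O F c ∧
      h = Matrix.GeneralLinearGroup.map (algebraMap O F) k₁ * diagGL ha hb *
        Matrix.GeneralLinearGroup.map (algebraMap O F) k₂ := by
  obtain ⟨⟨i₀, j₀⟩, hp⟩ := Finite.exists_max
    fun p : Fin 2 × Fin 2 => ValuationRing.valuation O F (h.1 p.1 p.2)
  have hdvd (i j : Fin 2) : ∃ t : O, h.1 i j = h.1 i₀ j₀ * algebraMap O F t := by
    obtain ⟨t, ht⟩ : ∃ t : O, t • h.1 i₀ j₀ = h.1 i j := hp (i, j)
    exact ⟨t, by rw [← ht, Algebra.smul_def, mul_comm]⟩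
  -- Permutations, written as addition in `Fin 2`, move the entry of largest valuation to the pivot
  -- position.
  let w : Fin 2 → GL (Fin 2) O := ![1, swapGL O]
  have hww (i : Fin 2) : w i * w i = 1 := by
    fin_cases i
    · simp [w]
    · exact Units.ext (swapGL O).mul_inv
  have hw (i j : Fin 2) (g : Matrix (Fin 2) (Fin 2) F) (k l : Fin 2) :
      ((w i).1.map (algebraMap O F) * g * (w j).1.map (algebraMap O F)) k l = g (i + k) (l + j) := by
    fin_cases i <;> fin_cases j <;> fin_cases k <;> fin_cases l <;>
      simp [w, swapGL, Matrix.mul_apply, Matrix.map_one]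
  let m := Matrix.GeneralLinearGroup.map (n := Fin 2) (algebraMap O F)
  obtain ⟨k₁, k₂, a, b, ha, hb, c, hc, hk⟩ := exists_cartan_of_dvd (O := O)
    (m (w i₀) * h * m (w j₀)) (fun i j => by
      obtain ⟨t, ht⟩ := hdvd (i₀ + i) (j + j₀)
      refine ⟨t, ?_⟩
      refine (hw i₀ j₀ h.1 i j).trans (ht.trans ?_)
      refine congrArg (· * _) (Eq.trans ?_ (hw i₀ j₀ h.1 0 0).symm)
      simp)
  refine ⟨w i₀ * k₁, k₂ * w j₀, a, b, ha, hb, c, hc, ?_⟩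
  have h1 (i : Fin 2) : m (w i) * m (w i) = 1 := by rw [← map_mul, hww, map_one]
  calc h = m (w i₀) * (m (w i₀) * h * m (w j₀)) * m (w j₀) := by
        simp only [mul_assoc, h1, mul_one]
        rw [← mul_assoc, h1, one_mul]
    _ = _ := by rw [hk, map_mul, map_mul]; simp only [mul_assoc, m]

/-- Among the elements of one maximal order, those carried into a second maximal order by
multiplication with `p` are those of a third one. -/
theorem exists_conjOrder_smul_mem_iff [IsDomain O] [ValuationRing O] [IsFractionRing O F]
    (g₁ g₂ : GL (Fin 2) F) {p : O} (hp : p ≠ 0) :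
    ∃ g₃ : GL (Fin 2) F, ∀ x ∈ conjOrder O g₁, p • x ∈ conjOrder O g₂ ↔ x ∈ conjOrder O g₃ := by
  obtain ⟨k₁, k₂, a, b, ha, hb, c, rfl, hk⟩ := exists_cartan (O := O) (g₁⁻¹ * g₂)
  have hp' : algebraMap O F p ≠ 0 := by simpa using hp
  set u := g₁ * Matrix.GeneralLinearGroup.map (algebraMap O F) k₁ with hu
  have h1 : conjOrder O g₁ = conjOrder O (u * 1) := by rw [mul_one, conjOrder_mul_map]
  have h2 : conjOrder O g₂ = conjOrder O (u * diagGL ha hb) := by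
    rw [← conjOrder_mul_map (u * _) k₂, hu, mul_assoc, mul_assoc, ← mul_assoc
      (Matrix.GeneralLinearGroup.map _ k₁), ← hk, mul_inv_cancel_left]
  have hc' : algebraMap O F c ≠ 0 := right_ne_zero_of_mul hb
  -- If c = pq, the only surviving condition is that q divides the lower left entry. If c divides p,
  -- every element of the first order qualifies.
  rcases ValuationRing.dvd_total p c with ⟨q, rfl⟩ | ⟨q, rfl⟩
  · have hq : algebraMap O F q ≠ 0 := by rw [map_mul] at hc'; exact right_ne_zero_of_mul hc'
    refine ⟨u * diagGL one_ne_zero hq, fun x hx => ?_⟩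
    rw [h1, mem_conjOrder_mul_iff] at hx
    rw [h2, mem_conjOrder_mul_iff, mem_conjOrder_mul_iff, mul_smul_comm, smul_mul_assoc]
    generalize (u⁻¹).1 * x * u.1 = y at hx
    obtain ⟨⟨y₁, e₁⟩, ⟨y₂, e₂⟩, ⟨y₃, e₃⟩, ⟨y₄, e₄⟩⟩ := mem_conjOrder_one_iff.1 hx
    rw [mem_conjOrder_diagGL_iff, mem_conjOrder_diagGL_iff]
    simp only [Matrix.smul_apply, Algebra.smul_def, ← e₁, ← e₂, ← e₃, ← e₄]
    have e : (a * algebraMap O F (p * q))⁻¹ * (algebraMap O F p * algebraMap O F y₃) * a =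
        (algebraMap O F q)⁻¹ * algebraMap O F y₃ * 1 := by
      rw [map_mul]; field_simp
    rw [e]
    refine ⟨fun h => ⟨⟨_, rfl⟩, ⟨y₂ * q, by simp⟩, h.2.2.1, ⟨_, rfl⟩⟩, fun h =>
      ⟨⟨p * y₁, by simp⟩, ⟨p * y₂ * (p * q), by simp only [map_mul]; field_simp⟩, h.2.2.1,
        ⟨p * y₄, by simp⟩⟩⟩
  · have hq : algebraMap O F q ≠ 0 := by rw [map_mul] at hp'; exact right_ne_zero_of_mul hp'
    refine ⟨g₁, fun x hx => iff_of_true ?_ hx⟩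
    rw [h1, mem_conjOrder_mul_iff] at hx
    rw [h2, mem_conjOrder_mul_iff, mul_smul_comm, smul_mul_assoc]
    generalize (u⁻¹).1 * x * u.1 = y at hx
    obtain ⟨⟨y₁, e₁⟩, ⟨y₂, e₂⟩, ⟨y₃, e₃⟩, ⟨y₄, e₄⟩⟩ := mem_conjOrder_one_iff.1 hx
    rw [mem_conjOrder_diagGL_iff]
    simp only [Matrix.smul_apply, Algebra.smul_def, ← e₁, ← e₂, ← e₃, ← e₄]
    exact ⟨⟨c * q * y₁, by simp⟩, ⟨c * q * y₂ * c, by simp only [map_mul]; field_simp⟩,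
      ⟨q * y₃, by simp only [map_mul]; field_simp⟩, ⟨c * q * y₄, by simp⟩⟩

end RelativePosition

/-! ### Elements common to a ball of the tree -/

section Balls

variable {O : Type*} {F : Type*} [CommRing O] [Field F] [Algebra O F] [IsFractionRing O F]

theorem algebraMap_pow_ne_zero {π : O} (hπ : Irreducible π) (n : ℕ) : algebraMap O F π ^ n ≠ 0 :=
  pow_ne_zero n (by simpa using hπ.ne_zero)

variable [IsDomain O] [IsIntegrallyClosed O]

/-- The vertices `g diag(1, πⁿ) M₂(O) diag(1, πⁿ)⁻¹ g⁻¹` of a ray. -/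
theorem areNeighbors_ray {π : O} (hπ : Irreducible π) (g : GL (Fin 2) F) (n : ℕ) :
    AreNeighbors
      (conjVertex O (g * diagGL one_ne_zero (algebraMap_pow_ne_zero (F := F) hπ n)))
      (conjVertex O (g * diagGL one_ne_zero (algebraMap_pow_ne_zero (F := F) hπ (n + 1)))) := by
  have hπ0 : algebraMap O F π ≠ 0 := by simpa using hπ.ne_zero
  refine ⟨g * diagGL one_ne_zero (algebraMap_pow_ne_zero hπ n), π, hπ, fun y => ?_, fun y => ?_⟩
  · have h := conj_mem_conjOrder_mul_iff (O := O) (h := 1) (y := y)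
      (g := g * diagGL one_ne_zero (algebraMap_pow_ne_zero hπ n))
    rw [mul_one] at h
    refine h.trans (mem_conjOrder_one_iff.trans ⟨?_, ?_⟩)
    · rintro ⟨⟨a, ha⟩, ⟨b, hb⟩, ⟨c, hc⟩, d, hd⟩
      exact ⟨a, b, c, d, by rw [ha, hb, hc, hd]; exact Matrix.eta_fin_two y⟩
    · rintro ⟨a, b, c, d, rfl⟩
      exact ⟨⟨a, rfl⟩, ⟨b, rfl⟩, ⟨c, rfl⟩, ⟨d, rfl⟩⟩
  · have hg : g * diagGL one_ne_zero (algebraMap_pow_ne_zero (F := F) hπ (n + 1)) =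
        g * diagGL one_ne_zero (algebraMap_pow_ne_zero hπ n) * diagGL one_ne_zero hπ0 := by
      rw [mul_assoc]
      congr 1
      refine Units.ext ?_
      simp [diagGL, Matrix.GeneralLinearGroup.mkOfDetNeZero, pow_succ]
    rw [hg]
    refine conj_mem_conjOrder_mul_iff.trans ((mem_conjOrder_diagGL_iff _ _).trans ⟨?_, ?_⟩)
    · rintro ⟨⟨a, ha⟩, ⟨b, hb⟩, ⟨c, hc⟩, d, hd⟩
      refine ⟨a, b, c, d, ?_⟩
      rw [ha, hb, hc, hd]
      nth_rw 1 [Matrix.eta_fin_two y]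
      congr 5 <;> field_simp
    · rintro ⟨a, b, c, d, rfl⟩
      exact ⟨⟨a, rfl⟩, ⟨b, by simp; field_simp⟩, ⟨c, by simp; field_simp⟩, ⟨d, rfl⟩⟩

theorem conjVertex_mem_treeBall {π : O} (hπ : Irreducible π) (g : GL (Fin 2) F) (r : ℕ) :
    conjVertex O (g * diagGL one_ne_zero (algebraMap_pow_ne_zero (F := F) hπ r)) ∈
      treeBall (conjVertex O g) r := by
  induction r with
  | zero =>
    have : g * diagGL one_ne_zero (algebraMap_pow_ne_zero (F := F) hπ 0) = g := by
      rw [mul_eq_left]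
      refine Units.ext ?_
      simp [diagGL, Matrix.GeneralLinearGroup.mkOfDetNeZero, Matrix.one_fin_two]
    rw [this]
    simp [treeBall]
  | succ n ih =>
    refine (SimpleGraph.edist_triangle (v := conjVertex O
      (g * diagGL one_ne_zero (algebraMap_pow_ne_zero (F := F) hπ n)))).trans ?_
    rw [Nat.cast_succ]
    refine add_le_add ih ?_
    by_cases h : conjVertex O (g * diagGL one_ne_zero (algebraMap_pow_ne_zero (F := F) hπ n)) =
        conjVertex O (g * diagGL one_ne_zero (algebraMap_pow_ne_zero (F := F) hπ (n + 1)))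
    · rw [h, SimpleGraph.edist_self]
      exact zero_le
    · exact (SimpleGraph.edist_eq_one_iff_adj.2
        ((SimpleGraph.fromRel_adj _ _ _).2 ⟨h, Or.inl (areNeighbors_ray hπ g n)⟩)).le

/-- An element of all maximal orders in a ball of radius `r` is congruent to a scalar
modulo `πʳ` times the center of the ball. -/
theorem exists_eq_add_smul_of_forall_mem_treeBall {π : O} (hπ : Irreducible π)
    (g : GL (Fin 2) F) (r : ℕ) {x : Matrix (Fin 2) (Fin 2) F}
    (hx : ∀ D ∈ treeBall (conjVertex O g) r, x ∈ D.1) :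
    ∃ z : O, ∃ h ∈ conjOrder O g, x = algebraMap O (Matrix (Fin 2) (Fin 2) F) z + π ^ r • h := by
  -- Right multiplication of `g` by `k` fixes the center and turns the ray; membership at its vertex
  -- of index r makes the lower left entry divisible by πʳ.
  have key (k : GL (Fin 2) O) : ∃ s : O,
      algebraMap O F (π ^ r * s) = (((k⁻¹).1.map (algebraMap O F)) * ((g⁻¹).1 * x * g.1) *
        k.1.map (algebraMap O F)) 1 0 := by
    have h1 := conjVertex_mem_treeBall hπ (g * Matrix.GeneralLinearGroup.map (algebraMap O F) k) r
    have h2 : conjVertex O (g * Matrix.GeneralLinearGroup.map (algebraMap O F) k) =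
        conjVertex O g := Subtype.ext (conjOrder_mul_map g k)
    rw [h2] at h1
    have h3 := mem_conjOrder_mul_iff.1 (hx _ h1)
    obtain ⟨s, hs⟩ := ((mem_conjOrder_diagGL_iff _ _).1 h3).2.2.1
    refine ⟨s, ?_⟩
    rw [map_mul, map_pow, hs, mul_one, mul_inv_cancel_left₀ (algebraMap_pow_ne_zero hπ r)]
    simp only [mul_inv_rev, Units.val_mul, mul_assoc, ← map_inv]
    rfl
  have hx0 : x ∈ conjOrder O g := hx (conjVertex O g) (by simp [treeBall])
  rw [← mul_one g, mem_conjOrder_mul_iff] at hx0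
  -- These three rays control y₁₀, y₀₁ and y₁₀ + y₁₁ − y₀₀ − y₀₁, hence also y₁₁ − y₀₀.
  obtain ⟨c, hc⟩ := key 1
  obtain ⟨b, hb⟩ := key (swapGL O)
  obtain ⟨t, ht⟩ := key (lowerGL 1)
  have hxy : x = g.1 * ((g⁻¹).1 * x * g.1) * (g⁻¹).1 := by
    simp only [mul_assoc, Units.mul_inv_cancel_left, Units.mul_inv, mul_one]
  generalize (g⁻¹).1 * x * g.1 = y at *
  obtain ⟨⟨a, ha⟩, -, -, -⟩ := mem_conjOrder_one_iff.1 hx0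
  have hc' : y 1 0 = algebraMap O F (π ^ r * c) := by
    rw [hc]; simp [Matrix.map_one]
  have hb' : y 0 1 = algebraMap O F (π ^ r * b) := by
    rw [hb]
    change _ = ((!![0, 1; 1, 0] : Matrix (Fin 2) (Fin 2) O).map (algebraMap O F) * y *
      (!![0, 1; 1, 0] : Matrix (Fin 2) (Fin 2) O).map (algebraMap O F)) 1 0
    simp [Matrix.mul_apply]
  have ht' : y 1 1 = algebraMap O F (a + π ^ r * (t + b - c)) := by
    have : algebraMap O F (π ^ r * t) = y 1 0 + y 1 1 - y 0 0 - y 0 1 := by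
      rw [ht]
      change ((!![1, 0; -1, 1] : Matrix (Fin 2) (Fin 2) O).map (algebraMap O F) * y *
        (!![1, 0; 1, 1] : Matrix (Fin 2) (Fin 2) O).map (algebraMap O F)) 1 0 = _
      simp [Matrix.mul_apply]
      ring
    rw [hc', hb', ← ha] at this
    rw [mul_sub, mul_add, map_add, map_sub, map_add, this]
    ring
  refine ⟨a, _, conjEmbedding_mem g !![0, b; c, t + b - c], ?_⟩
  rw [← (conjEmbedding O g).commutes, ← map_smul, ← map_add, hxy, conjEmbedding_apply]
  congr 2
  ext i j
  fin_cases i <;> fin_cases j <;> simp [Matrix.algebraMap_matrix_apply, ha, hb', hc', ht']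

end Balls

/-! ### Descent of membership from L to K -/

section BaseChange

variable {A K : Type*} [CommRing A] [IsIntegrallyClosed A] [Field K] [Algebra A K]
  [IsFractionRing A K] (L : Type*) [Field L] [Algebra K L] [Algebra A L] [IsScalarTower A K L]

/-- An element of `K` that is integral over `A` lies in `A`, so the extended order meets M₂(K) in
the original one. -/
theorem map_mem_conjOrder_map_iff (g : GL (Fin 2) K) (x : Matrix (Fin 2) (Fin 2) K) :
    x.map (algebraMap K L) ∈ conjOrder (integralClosure A L)
      (Matrix.GeneralLinearGroup.map (algebraMap K L) g) ↔ x ∈ conjOrder A g := by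
  have h : ((Matrix.GeneralLinearGroup.map (algebraMap K L) g)⁻¹).1 * x.map (algebraMap K L) *
      (Matrix.GeneralLinearGroup.map (algebraMap K L) g).1 =
      ((g⁻¹).1 * x * g.1).map (algebraMap K L) := by
    rw [Matrix.map_mul, Matrix.map_mul, ← map_inv]
    rfl
  rw [mem_conjOrder_iff, mem_conjOrder_iff, h]
  refine forall_congr' fun i => forall_congr' fun j => ?_
  rw [Matrix.map_apply, ← IsIntegralClosure.isIntegral_iff (R := A),
    isIntegral_algebraMap_iff (algebraMap K L).injective, IsIntegrallyClosed.isIntegral_iff]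

end BaseChange

/-! ### The main theorem -/

theorem proposition5p5 {K : Type u} [Field K] [ValuativeRel K] [TopologicalSpace K]
    [IsNonarchimedeanLocalField K] (π : 𝒪[K]) (hπ : Irreducible π)
    (R : Subalgebra 𝒪[K] (Matrix (Fin 2) (Fin 2) K)) (hR : IsGhostIntersection R)
    (r : ℕ) (D : MaximalOrder 𝒪[K] K) (hball : treeBall D r ⊆ branch R) :
    ∃ R' : Subalgebra 𝒪[K] (Matrix (Fin 2) (Fin 2) K),
      IsGhostIntersection R' ∧ R = scalarsAdd (π ^ r) R' := by
  obtain ⟨-, L, _, _, _, n, E, hE⟩ := hR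
  have : IsFractionRing (integralClosure 𝒪[K] L) L :=
    integralClosure.isFractionRing_of_finite_extension K L
  have : ValuationRing (integralClosure 𝒪[K] L) := valuationRing_integralClosure L
  obtain ⟨g, hg⟩ := D.2.exists_eq_conjOrder
  obtain rfl : D = conjVertex 𝒪[K] g := Subtype.ext hg
  let p : integralClosure 𝒪[K] L := algebraMap 𝒪[K] _ (π ^ r)
  have hpL : algebraMap (integralClosure 𝒪[K] L) L p =
      algebraMap K L (algebraMap 𝒪[K] K (π ^ r)) := rfl
  have hp : p ≠ 0 := by
    intro h
    rw [h, map_zero, eq_comm, map_eq_zero, map_pow] at hpL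
    exact algebraMap_pow_ne_zero hπ r hpL
  let gL := Matrix.GeneralLinearGroup.map (algebraMap K L) g
  have hex (i : Fin n) : ∃ g' : GL (Fin 2) L, ∀ x ∈ conjOrder (integralClosure 𝒪[K] L) gL,
      p • x ∈ (E i).1 ↔ x ∈ conjOrder (integralClosure 𝒪[K] L) g' := by
    obtain ⟨gi, hgi⟩ := (E i).2.exists_eq_conjOrder
    rw [hgi]
    exact exists_conjOrder_smul_mem_iff gL gi hp
  choose g' hg' using hex
  have hsmul (x : Matrix (Fin 2) (Fin 2) K) :
      (π ^ r • x).map (algebraMap K L) = p • x.map (algebraMap K L) := by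
    ext i j
    rw [Matrix.map_apply, Matrix.smul_apply, Matrix.smul_apply, Matrix.map_apply,
      Algebra.smul_def, Algebra.smul_def, map_mul, hpL]
  have hmem (x : Matrix (Fin 2) (Fin 2) K) (hx : x ∈ conjOrder 𝒪[K] g) :
      π ^ r • x ∈ R ↔ ∀ i, x.map (algebraMap K L) ∈
        conjOrder (integralClosure 𝒪[K] L) (g' i) := by
    rw [hE]
    refine forall_congr' fun i => ?_
    rw [hsmul]
    exact hg' i _ ((map_mem_conjOrder_map_iff L g x).2 hx)
  -- The extra order, the base change of `D`, keeps `R'` inside `D`. This makes `R'` finitely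
  -- generated and the moved orders applicable.
  let G : Fin (n + 1) → GL (Fin 2) L := Fin.cons gL g'
  let φ : Matrix (Fin 2) (Fin 2) K →ₐ[𝒪[K]] Matrix (Fin 2) (Fin 2) L :=
    (IsScalarTower.toAlgHom 𝒪[K] K L).mapMatrix
  let R' : Subalgebra 𝒪[K] (Matrix (Fin 2) (Fin 2) K) :=
    ⨅ i, ((conjOrder (integralClosure 𝒪[K] L) (G i)).restrictScalars 𝒪[K]).comap φ
  have hR' (x : Matrix (Fin 2) (Fin 2) K) : x ∈ R' ↔
      ∀ i, x.map (algebraMap K L) ∈ conjOrder (integralClosure 𝒪[K] L) (G i) := by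
    rw [Algebra.mem_iInf]
    rfl
  have hR'' (x : Matrix (Fin 2) (Fin 2) K) : x ∈ R' ↔ x ∈ conjOrder 𝒪[K] g ∧
      ∀ i, x.map (algebraMap K L) ∈ conjOrder (integralClosure 𝒪[K] L) (g' i) := by
    rw [hR', Fin.forall_fin_succ]
    exact and_congr_left' (map_mem_conjOrder_map_iff L g x)
  refine ⟨R', ⟨?_, L, _, _, ‹_›, n + 1, fun i => conjVertex _ (G i), hR'⟩, ?_⟩
  · have hfin : Module.Finite 𝒪[K] (conjOrder 𝒪[K] g) := isOrder_conjOrder g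
    have hle : R' ≤ conjOrder 𝒪[K] g := fun x hx => ((hR'' x).1 hx).1
    exact Module.Finite.of_injective (Subalgebra.inclusion hle).toLinearMap
      (Subalgebra.inclusion_injective hle)
  · refine le_antisymm (fun x hx => ?_) ?_
    · obtain ⟨z, h, hh, rfl⟩ := exists_eq_add_smul_of_forall_mem_treeBall hπ g r
        fun D hD => hball hD hx
      refine ⟨z, h, (hR'' h).2 ⟨hh, (hmem h hh).1 ?_⟩, rfl⟩
      simpa using sub_mem hx (R.algebraMap_mem z)
    · rintro _ ⟨z, h, hh, rfl⟩
      obtain ⟨hh1, hh2⟩ := (hR'' h).1 hh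
      exact add_mem (R.algebraMap_mem z) ((hmem h hh1).2 hh2)
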